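/- Let $Z$ be a standard Gaussian random variable and put \[ \mu = E[|Z|],\qquad \sigma^2 = \operatorname{Var}(|Z|),\qquad \kappa^2 = E\left[\left((|Z|-\mu)^2-\sigma^2|Z|^2\right)^2\right],\qquad \kappa = \sqrt{\kappa^2}. \] Then \[ \mu=\sqrt{2/\pi},\qquad \sigma^2 = 1-\frac{2}{\pi},\qquad \kappa^2=\frac{8(\pi-3)}{\pi^2}. \] For every $n$, let $X_1,\dots,X_n$ be independent standard Gaussian random variables (the samples for different $n$ may be unrelated and defined on different probability spaces), and let $\overline{X}=\frac{1}{n}\sum_{i=1}^n X_i$ and $\overline{X}'=\frac{1}{n}\sum_{i=1}^n |X_i|$. Then the quantity \[ \frac{\sqrt{n}}{\kappa}\left[\frac{\frac{1}{n}\sum_{i=1}^n(|X_i|-\overline{X}')^2}{\frac{1}{n}\sum_{i=1}^n(X_i-\overline{X})^2} - \sigma^2\right] \] (whose denominator is almost surely nonzero for $n\ge 2$) converges in distribution to a standard Gaussian random variable as $n\to\infty$. -/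

import Mathlib

open MeasureTheory ProbabilityTheory Filter

noncomputable section

/-- The sample mean `(1/n) ∑ xᵢ`. -/
def sampleMean {n : ℕ} (x : Fin n → ℝ) : ℝ :=
  (1 / (n : ℝ)) * ∑ i, x i

/-- The empirical variance `(1/n) ∑ (xᵢ - x̄)²`, normalised by `n`. -/
def empiricalVariance {n : ℕ} (x : Fin n → ℝ) : ℝ :=
  (1 / (n : ℝ)) * ∑ i, (x i - sampleMean x) ^ 2

/-- `μ = E|Z|` for a standard Gaussian `Z`. -/
def absMean : ℝ := ∫ z, |z| ∂(gaussianReal 0 1)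

/-- `σ² = Var |Z|` for a standard Gaussian `Z`. -/
def absVar : ℝ := variance (fun z : ℝ => |z|) (gaussianReal 0 1)

/-- `κ² = E[((|Z| - μ)² - σ² |Z|²)²]` for a standard Gaussian `Z`. -/
def kappaSq : ℝ :=
  ∫ z, ((|z| - absMean) ^ 2 - absVar * |z| ^ 2) ^ 2 ∂(gaussianReal 0 1)

/-- The standardised ratio
`(√n / κ) * (empirical variance of |xᵢ| / empirical variance of xᵢ - σ²)`. -/
def standardizedRatio {n : ℕ} (x : Fin n → ℝ) : ℝ :=
  (√(n : ℝ) / √kappaSq) *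
    (empiricalVariance (fun i => |x i|) / empiricalVariance x - absVar)

end

section AbsoluteMoments

/-! Write `T/S - σ² = (T - σ² S)/S`, with `T`, `S` the empirical variances of `|Xᵢ|` and `Xᵢ`.
Expanding both about the true means `μ` and `0` turns the numerator into the average of the i.i.d.
terms `(|Xᵢ| - μ)² - σ²|Xᵢ|²`, plus multiples of two squared deviations of sample means
(`standardizedRatio_eq`). The terms have mean zero and variance `κ² > 0`, so the central limit
theorem applies. The squares are of order `1/n` in mean and vanish after scaling by `√n`, while `S →
1` almost surely. Slutsky's theorem concludes. -/

lemma integrable_abs_pow_gaussianReal (k : ℕ) :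
    Integrable (fun z : ℝ => |z| ^ k) (gaussianReal 0 1) := by
  simpa using (memLp_id_gaussianReal (μ := 0) (v := 1) k).integrable_norm_pow'

/-- Evenness folds the integral onto the half-line, where it is a Gamma integral. -/
lemma integral_abs_pow_gaussianReal (k : ℕ) :
    ∫ z, |z| ^ k ∂(gaussianReal 0 1) =
      2 * (√(2 * Real.pi))⁻¹ *
        ((1 / 2 : ℝ) ^ (-((k : ℝ) + 1) / 2) * (1 / 2) * Real.Gamma (((k : ℝ) + 1) / 2)) := by
  rw [integral_gaussianReal_eq_integral_smul one_ne_zero,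
    ← integral_rpow_mul_exp_neg_mul_rpow (by norm_num) (by linarith [k.cast_nonneg (α := ℝ)])
      (by norm_num)]
  have h := integral_comp_abs
    (f := fun x : ℝ => (√(2 * Real.pi))⁻¹ * (x ^ (k : ℝ) * Real.exp (-(1 / 2) * x ^ (2 : ℝ))))
  rw [integral_const_mul (μ := volume.restrict _)] at h
  rw [mul_assoc, ← h]
  refine integral_congr_ae (.of_forall fun x => ?_)
  simp only [gaussianPDFReal, smul_eq_mul, Real.rpow_natCast, Real.rpow_ofNat, sq_abs,
    NNReal.coe_one, mul_one, sub_zero]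
  rw [show -x ^ 2 / 2 = -(1 / 2) * x ^ 2 by ring]
  ring

lemma integral_abs_gaussianReal : ∫ z, |z| ∂(gaussianReal 0 1) = √(2 / Real.pi) := by
  have h := integral_abs_pow_gaussianReal 1
  have hpi := Real.pi_pos
  have h2 : √2 ^ 2 = 2 := Real.sq_sqrt (by norm_num)
  norm_num [Real.rpow_neg_one] at h
  rw [h, Real.sqrt_div (by norm_num)]
  field_simp
  linarith

lemma integral_abs_sq_gaussianReal : ∫ z, |z| ^ 2 ∂(gaussianReal 0 1) = 1 := by
  have h := variance_eq_sub (memLp_id_gaussianReal (μ := 0) (v := 1) 2)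
  simp only [variance_id_gaussianReal, id_eq, integral_id_gaussianReal, Pi.pow_apply] at h
  simpa using h.symm

lemma integral_abs_pow_three_gaussianReal :
    ∫ z, |z| ^ 3 ∂(gaussianReal 0 1) = 2 * √(2 / Real.pi) := by
  have h := integral_abs_pow_gaussianReal 3
  have hpi := Real.pi_pos
  have h2 : √2 ^ 2 = 2 := Real.sq_sqrt (by norm_num)
  have hG : Real.Gamma 2 = 1 := by simp
  norm_num [hG] at h
  rw [h, Real.sqrt_div (by norm_num)]
  field_simp
  linarith

lemma integral_abs_pow_four_gaussianReal : ∫ z, |z| ^ 4 ∂(gaussianReal 0 1) = 3 := by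
  have h := integral_abs_pow_gaussianReal 4
  have hpi := Real.pi_pos
  have h2 : √2 ^ 2 = 2 := Real.sq_sqrt (by norm_num)
  have hG : Real.Gamma (5 / 2) = 3 / 4 * √Real.pi := by
    rw [show (5 / 2 : ℝ) = 1 / 2 + 1 + 1 by norm_num, Real.Gamma_add_one (by norm_num),
      Real.Gamma_add_one (by norm_num), Real.Gamma_one_half_eq]
    ring
  have hp : (1 / 2 : ℝ) ^ (-(5 / 2) : ℝ) = 4 * √2 := by
    rw [one_div, Real.inv_rpow (by norm_num), ← Real.rpow_neg (by norm_num),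
      show -(-(5 / 2) : ℝ) = 2 + 1 / 2 by norm_num, Real.rpow_add (by norm_num),
      ← Real.sqrt_eq_rpow]
    norm_num
  norm_num only [Nat.cast_ofNat] at h
  norm_num only [hG, hp] at h
  rw [h, Real.sqrt_mul (by norm_num)]
  field_simp

end AbsoluteMoments

section Constants

lemma absMean_eq : absMean = √(2 / Real.pi) := integral_abs_gaussianReal

lemma absMean_sq : absMean ^ 2 = 2 / Real.pi := by
  rw [absMean_eq, Real.sq_sqrt (by positivity)]

lemma memLp_abs_gaussianReal : MemLp (fun z : ℝ => |z|) 2 (gaussianReal 0 1) :=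
  (memLp_id_gaussianReal (μ := 0) (v := 1) 2).norm

lemma absVar_eq_sub_sq : absVar = 1 - absMean ^ 2 := by
  rw [absVar, variance_eq_sub memLp_abs_gaussianReal, absMean]
  congr 1
  exact integral_abs_sq_gaussianReal

/-- The summand `(|z| - μ)² - σ² |z|²` of the linearised statistic. -/
noncomputable def linearizedSummand (z : ℝ) : ℝ := (|z| - absMean) ^ 2 - absVar * |z| ^ 2

lemma continuous_linearizedSummand : Continuous linearizedSummand := by
  unfold linearizedSummand
  fun_prop

lemma integral_linearizedSummand : ∫ z, linearizedSummand z ∂(gaussianReal 0 1) = 0 := by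
  have h (z : ℝ) : linearizedSummand z =
      absMean ^ 2 * |z| ^ 2 - 2 * absMean * |z| ^ 1 + absMean ^ 2 := by
    rw [linearizedSummand, absVar_eq_sub_sq]
    ring
  have i (k : ℕ) (c : ℝ) : Integrable (fun z : ℝ => c * |z| ^ k) (gaussianReal 0 1) :=
    (integrable_abs_pow_gaussianReal k).const_mul c
  simp_rw [h]
  rw [integral_add (by fun_prop) (by fun_prop), integral_sub (by fun_prop) (by fun_prop)]
  simp_rw [integral_const_mul, pow_one]
  rw [integral_abs_sq_gaussianReal, ← absMean]
  simp
  ring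

lemma kappaSq_eq : kappaSq = 8 * (Real.pi - 3) / Real.pi ^ 2 := by
  have h (z : ℝ) : ((|z| - absMean) ^ 2 - absVar * |z| ^ 2) ^ 2 =
      absMean ^ 4 * |z| ^ 4 - 4 * absMean ^ 3 * |z| ^ 3 +
        (4 * absMean ^ 2 + 2 * absMean ^ 4) * |z| ^ 2 - 4 * absMean ^ 3 * |z| ^ 1 +
          absMean ^ 4 := by
    rw [absVar_eq_sub_sq]
    ring
  have i (k : ℕ) (c : ℝ) : Integrable (fun z : ℝ => c * |z| ^ k) (gaussianReal 0 1) :=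
    (integrable_abs_pow_gaussianReal k).const_mul c
  rw [kappaSq]
  simp_rw [h]
  rw [integral_add (by fun_prop) (by fun_prop), integral_sub (by fun_prop) (by fun_prop),
    integral_add (by fun_prop) (by fun_prop), integral_sub (by fun_prop) (by fun_prop)]
  simp_rw [integral_const_mul, pow_one]
  rw [integral_abs_sq_gaussianReal, integral_abs_pow_three_gaussianReal,
    integral_abs_pow_four_gaussianReal, ← absMean_eq, ← absMean]
  have hpi := Real.pi_pos
  simp only [integral_const, probReal_univ, smul_eq_mul]
  -- As `E|Z|³ = 2μ`, only even powers of `μ` remain, and `μ² = 2/π` suffices.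
  calc _ = 4 * absMean ^ 2 - 6 * (absMean ^ 2) ^ 2 := by ring
    _ = _ := by rw [absMean_sq]; field_simp; ring

lemma kappaSq_pos : 0 < kappaSq := by
  rw [kappaSq_eq]
  have := Real.pi_gt_three
  have : 0 < Real.pi - 3 := by linarith
  positivity

end Constants

section SampleStatistics

/-- The centre `c` is free so that the random sample mean can be traded for the true mean. -/
lemma empiricalVariance_eq_sub_sq {n : ℕ} (hn : n ≠ 0) (x : Fin n → ℝ) (c : ℝ) :
    empiricalVariance x =
      (1 / (n : ℝ)) * ∑ i, (x i - c) ^ 2 - (sampleMean x - c) ^ 2 := by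
  have hn' : (n : ℝ) ≠ 0 := Nat.cast_ne_zero.2 hn
  have hs : ∑ i, (x i - c) = n * (sampleMean x - c) := by
    rw [Finset.sum_sub_distrib, sampleMean]
    simp
    field_simp
  have h (i : Fin n) : (x i - sampleMean x) ^ 2 =
      (x i - c) ^ 2 - 2 * (sampleMean x - c) * (x i - c) + (sampleMean x - c) ^ 2 := by ring
  rw [empiricalVariance]
  simp_rw [h]
  rw [Finset.sum_add_distrib, Finset.sum_sub_distrib, ← Finset.mul_sum, hs]
  simp
  field_simp
  ring

lemma standardizedRatio_eq {n : ℕ} (hn : n ≠ 0) (x : Fin n → ℝ) (hx : empiricalVariance x ≠ 0) :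
    standardizedRatio x =
      ((√(n : ℝ))⁻¹ * ∑ i, linearizedSummand (x i) / √kappaSq
        + (-1 / √kappaSq) * √(n : ℝ) * (sampleMean (fun i => |x i|) - absMean) ^ 2
        + (absVar / √kappaSq) * √(n : ℝ) * (sampleMean x - 0) ^ 2)
      * (empiricalVariance x)⁻¹ := by
  have hn' : (0 : ℝ) < n := by positivity
  have hκ := Real.sqrt_pos.2 kappaSq_pos
  have hsq : √(n : ℝ) ^ 2 = n := Real.sq_sqrt hn'.le
  have hsn := Real.sqrt_pos.2 hn'
  have h1 := empiricalVariance_eq_sub_sq hn (fun i => |x i|) absMean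
  have h2 := empiricalVariance_eq_sub_sq hn x 0
  have hw : ∑ i, linearizedSummand (x i) =
      ∑ i, (|x i| - absMean) ^ 2 - absVar * ∑ i, (x i - 0) ^ 2 := by
    simp [linearizedSummand, Finset.mul_sum]
  have hnum : empiricalVariance (fun i => |x i|) - absVar * empiricalVariance x =
      (1 / (n : ℝ)) * ∑ i, linearizedSummand (x i)
        - (sampleMean (fun i => |x i|) - absMean) ^ 2
        + absVar * (sampleMean x - 0) ^ 2 := by
    rw [h1, h2, hw]
    ring
  have hdiv : empiricalVariance (fun i => |x i|) / empiricalVariance x - absVar =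
      (empiricalVariance (fun i => |x i|) - absVar * empiricalVariance x)
        * (empiricalVariance x)⁻¹ := by
    field_simp
  have hinv : √(n : ℝ) * (1 / n) = (√(n : ℝ))⁻¹ := by
    field_simp
    exact hsq
  rw [standardizedRatio, hdiv, hnum, ← mul_assoc, ← Finset.sum_div, ← hinv]
  ring

lemma measurable_standardizedRatio (n : ℕ) :
    Measurable (standardizedRatio : (Fin n → ℝ) → ℝ) := by
  unfold standardizedRatio empiricalVariance sampleMean
  fun_prop

end SampleStatistics

section Limits

variable {Ω : Type*} {mΩ : MeasurableSpace Ω} {Q : Measure Ω}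

/-- The strong law of large numbers for `sampleMean`. -/
lemma ae_tendsto_sampleMean {Y : ℕ → Ω → ℝ} (hint : Integrable (Y 0) Q)
    (hindep : iIndepFun Y Q) (hident : ∀ i, IdentDistrib (Y i) (Y 0) Q Q) :
    ∀ᵐ ω ∂Q, Tendsto (fun n : ℕ => sampleMean (fun i : Fin n => Y i ω)) atTop (nhds Q[Y 0]) := by
  filter_upwards [strong_law_ae_real Y hint (fun i j hij => hindep.indepFun hij) hident] with ω hω
  refine hω.congr fun n => ?_
  rw [sampleMean, Fin.sum_univ_eq_sum_range (fun i => Y i ω)]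
  ring

variable [IsProbabilityMeasure Q]

/-- The squared deviation of the mean of square-integrable i.i.d. variables is `o(1/√n)`
in probability. -/
lemma tendstoInMeasure_sqrt_mul_sampleMean_sub_sq {Y : ℕ → Ω → ℝ} (hL : MemLp (Y 0) 2 Q)
    (hindep : iIndepFun Y Q) (hident : ∀ i, IdentDistrib (Y i) (Y 0) Q Q) (c m : ℝ)
    (hm : Q[Y 0] = m) :
    TendstoInMeasure Q
      (fun (n : ℕ) ω => c * √(n : ℝ) * (sampleMean (fun i : Fin n => Y i ω) - m) ^ 2)
      atTop (fun _ => 0) := by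
  have hLp (i : ℕ) : MemLp (Y i) 2 Q := (hident i).memLp_iff.2 hL
  have hmem (n : ℕ) : MemLp (fun ω => sampleMean (fun i : Fin n => Y i ω)) 2 Q :=
    (memLp_finsetSum _ fun (i : Fin n) _ => hLp i).const_mul _
  have hvar {n : ℕ} (hn : n ≠ 0) :
      ∫ ω, (sampleMean (fun i : Fin n => Y i ω) - m) ^ 2 ∂Q = Var[Y 0; Q] / n := by
    have hn' : (n : ℝ) ≠ 0 := Nat.cast_ne_zero.2 hn
    have hmean : ∫ ω, sampleMean (fun i : Fin n => Y i ω) ∂Q = m := by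
      simp only [sampleMean]
      rw [integral_const_mul, integral_finsetSum _ fun i _ => (hLp _).integrable (by norm_num)]
      simp_rw [fun i => (hident i).integral_eq, hm]
      simp
      field_simp
    have hV : Var[fun ω => sampleMean (fun i : Fin n => Y i ω); Q] = Var[Y 0; Q] / n := by
      simp only [sampleMean]
      rw [variance_const_mul]
      have := IndepFun.variance_sum (μ := Q) (s := Finset.univ) (X := fun i : Fin n => Y i)
        (fun i _ => hLp i) (fun i _ j _ hij => hindep.indepFun (by simpa [Fin.ext_iff] using hij))
      rw [Finset.sum_fn] at this
      rw [this]
      simp_rw [fun i => (hident i).variance_eq]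
      simp
      field_simp
    rw [variance_eq_integral (hmem n).aemeasurable, hmean] at hV
    exact hV
  rw [tendstoInMeasure_iff_measureReal_norm]
  intro ε hε
  have hlim : Tendsto (fun n : ℕ => |c| * Var[Y 0; Q] / ε * (√(n : ℝ))⁻¹) atTop (nhds 0) := by
    simpa using ((tendsto_inv_atTop_zero.comp
      (Real.tendsto_sqrt_atTop.comp tendsto_natCast_atTop_atTop)).const_mul
        (|c| * Var[Y 0; Q] / ε))
  refine squeeze_zero' (.of_forall fun _ => measureReal_nonneg) ?_ hlim
  filter_upwards [eventually_ne_atTop 0] with n hn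
  have hn' : (0 : ℝ) < n := by positivity
  have hsn := Real.sqrt_pos.2 hn'
  have hsq : √(n : ℝ) ^ 2 = n := Real.sq_sqrt hn'.le
  have hint : Integrable (fun ω => (sampleMean (fun i : Fin n => Y i ω) - m) ^ 2) Q :=
    ((hmem n).sub (memLp_const m)).integrable_sq
  -- Markov's inequality: the mean is `|c| √n · Var/n`, which gives the bound in `hlim`.
  have hmk := mul_meas_ge_le_integral_of_nonneg (μ := Q)
    (f := fun ω => ‖c * √(n : ℝ) * (sampleMean (fun i : Fin n => Y i ω) - m) ^ 2 - 0‖)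
    (.of_forall fun _ => norm_nonneg _) (by simpa using (hint.const_mul (c * √(n : ℝ))).norm) ε
  have hI : ∫ ω, ‖c * √(n : ℝ) * (sampleMean (fun i : Fin n => Y i ω) - m) ^ 2 - 0‖ ∂Q =
      |c| * √(n : ℝ) * ∫ ω, (sampleMean (fun i : Fin n => Y i ω) - m) ^ 2 ∂Q := by
    rw [← integral_const_mul]
    simp [abs_of_pos hsn]
  rw [hI, hvar hn, ← le_div_iff₀' hε] at hmk
  refine hmk.trans (le_of_eq ?_)
  field_simp
  rw [hsq]
  ring

variable {G : ℕ → Ω → ℝ}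

lemma ae_tendsto_empiricalVariance (hlaw : ∀ i, HasLaw (G i) (gaussianReal 0 1) Q)
    (hindep : iIndepFun G Q) :
    ∀ᵐ ω ∂Q, Tendsto (fun n : ℕ => empiricalVariance (fun i : Fin n => G i ω)) atTop (nhds 1) := by
  have hident (i : ℕ) : IdentDistrib (G i) (G 0) Q Q :=
    ⟨(hlaw i).aemeasurable, (hlaw 0).aemeasurable, (hlaw i).map_eq.trans (hlaw 0).map_eq.symm⟩
  have hL : MemLp (G 0) 2 Q := by
    have h := memLp_id_gaussianReal (μ := 0) (v := 1) 2
    rw [← (hlaw 0).map_eq] at h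
    exact h.comp_of_map (hlaw 0).aemeasurable
  have hE : Q[G 0] = 0 := by rw [(hlaw 0).integral_eq, integral_id_gaussianReal]
  have hE2 : ∫ ω, G 0 ω ^ 2 ∂Q = 1 := by
    have := (hlaw 0).integral_comp (f := fun z : ℝ => |z| ^ 2) (by fun_prop)
    rw [integral_abs_sq_gaussianReal] at this
    simpa using this
  have h1 := ae_tendsto_sampleMean (hL.integrable (by norm_num)) hindep hident
  have h2 := ae_tendsto_sampleMean (Y := fun i ω => G i ω ^ 2) hL.integrable_sq
    (hindep.comp (fun _ x => x ^ 2) (by fun_prop))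
    (fun i => (hident i).comp (u := fun x => x ^ 2) (by fun_prop))
  filter_upwards [h1, h2] with ω hω1 hω2
  rw [hE] at hω1
  rw [hE2] at hω2
  have h := hω2.sub (hω1.pow 2)
  simp only [ne_eq, OfNat.ofNat_ne_zero, not_false_eq_true, zero_pow, sub_zero] at h
  refine h.congr' ?_
  filter_upwards [eventually_ne_atTop 0] with n hn
  rw [empiricalVariance_eq_sub_sq hn _ 0]
  simp [sampleMean]

/-- The limit theorem for the first `n` terms of a single i.i.d. sequence. -/
lemma tendstoInDistribution_standardizedRatio_of_sequence
    (hlaw : ∀ i, HasLaw (G i) (gaussianReal 0 1) Q) (hindep : iIndepFun G Q)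
    {Ω' : Type*} {mΩ' : MeasurableSpace Ω'} {P' : Measure Ω'} [IsProbabilityMeasure P']
    {Z : Ω' → ℝ} (hZ : HasLaw Z (gaussianReal 0 1) P') :
    TendstoInDistribution (fun (n : ℕ) ω => standardizedRatio (fun i : Fin n => G i ω)) atTop Z
      (fun _ => Q) P' := by
  have hG (i : ℕ) : AEMeasurable (G i) Q := (hlaw i).aemeasurable
  have hident (i : ℕ) : IdentDistrib (G i) (G 0) Q Q :=
    ⟨hG i, hG 0, (hlaw i).map_eq.trans (hlaw 0).map_eq.symm⟩
  have hvec (n : ℕ) : AEMeasurable (fun ω (i : Fin n) => G i ω) Q :=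
    aemeasurable_pi_lambda _ fun i => hG i
  have hκ := Real.sqrt_pos.2 kappaSq_pos
  have hcomp {f : ℝ → ℝ} (hf : MemLp f 2 (gaussianReal 0 1)) : MemLp (fun ω => f (G 0 ω)) 2 Q := by
    rw [← (hlaw 0).map_eq] at hf
    exact hf.comp_of_map (hG 0)
  -- the central limit theorem for the linear part
  have hCLT : TendstoInDistribution
      (fun (n : ℕ) ω => (√(n : ℝ))⁻¹ * ∑ i : Fin n, linearizedSummand (G i ω) / √kappaSq)
      atTop Z (fun _ => Q) P' := by
    have hf : Measurable fun z => linearizedSummand z / √kappaSq :=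
      continuous_linearizedSummand.measurable.div_const _
    have h := tendstoInDistribution_inv_sqrt_mul_sum
      (X := fun i ω => linearizedSummand (G i ω) / √kappaSq) hZ ?_ ?_
      (hindep.comp (fun _ z => linearizedSummand z / √kappaSq) (fun _ => hf))
      (fun i => (hident i).comp (u := fun z => linearizedSummand z / √kappaSq) hf)
    · refine h.congr (fun n => .of_forall fun ω => ?_) .rfl
      exact congrArg _
        (Fin.sum_univ_eq_sum_range (fun i => linearizedSummand (G i ω) / √kappaSq) n).symm
    · have := (hlaw 0).integral_comp hf.aestronglyMeasurable
      rw [integral_div, integral_linearizedSummand, zero_div] at this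
      exact this
    · have := (hlaw 0).integral_comp (hf.pow_const 2).aestronglyMeasurable
      refine this.trans ?_
      simp only [div_pow, Real.sq_sqrt kappaSq_pos.le]
      rw [integral_div]
      exact div_self kappaSq_pos.ne'
  have hB1 := tendstoInMeasure_sqrt_mul_sampleMean_sub_sq (Y := fun i ω => |G i ω|)
    (hcomp memLp_abs_gaussianReal) (hindep.comp (fun _ x => |x|) (by fun_prop))
    (fun i => (hident i).comp (u := fun x => |x|) (by fun_prop)) (-1 / √kappaSq) absMean
    ((hlaw 0).integral_comp (f := fun z : ℝ => |z|) (by fun_prop))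
  have hB2 := tendstoInMeasure_sqrt_mul_sampleMean_sub_sq
    (hcomp (memLp_id_gaussianReal (μ := 0) (v := 1) 2)) hindep hident (absVar / √kappaSq) 0
    (by rw [(hlaw 0).integral_eq, integral_id_gaussianReal])
  have hae := ae_tendsto_empiricalVariance hlaw hindep
  have hS_meas (n : ℕ) : AEMeasurable (fun ω => (empiricalVariance (fun i : Fin n => G i ω))⁻¹) Q := by
    unfold empiricalVariance sampleMean
    fun_prop
  have hS : TendstoInMeasure Q
      (fun (n : ℕ) ω => (empiricalVariance (fun i : Fin n => G i ω))⁻¹) atTop (fun _ => 1) := by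
    refine tendstoInMeasure_of_tendsto_ae (fun n => (hS_meas n).aestronglyMeasurable) ?_
    filter_upwards [hae] with ω hω
    simpa using hω.inv₀ one_ne_zero
  have h1 := hCLT.add_of_tendstoInMeasure_const hB1 fun n => by
    unfold sampleMean
    fun_prop
  have h2 := h1.add_of_tendstoInMeasure_const hB2 fun n => by
    unfold sampleMean
    fun_prop
  -- Slutsky for products: the inverse empirical variance tends to `1` in probability.
  have h3 := h2.continuous_comp_prodMk_of_tendstoInMeasure_const
    (g := fun p : ℝ × ℝ => p.1 * p.2) (by fun_prop) hS hS_meas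
  simp only [add_zero, mul_one] at h3
  have hmeas (n : ℕ) : AEMeasurable (fun ω => standardizedRatio (fun i : Fin n => G i ω)) Q :=
    (measurable_standardizedRatio n).comp_aemeasurable (hvec n)
  -- The decomposition needs a nonzero denominator. Almost surely this holds for all large `n`,
  -- since the limit is `1`, so the difference is eventually zero.
  refine tendstoInDistribution_of_tendstoInMeasure_sub _ _ h3 ?_ hmeas
  refine tendstoInMeasure_of_tendsto_ae
    (fun n => ((hmeas n).sub (h3.forall_aemeasurable n)).aestronglyMeasurable) ?_
  filter_upwards [hae] with ω hω
  refine tendsto_const_nhds.congr' ?_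
  filter_upwards [eventually_ne_atTop 0, hω.eventually_ne one_ne_zero] with n hn hne
  simp [standardizedRatio_eq hn _ hne]

end Limits

theorem mainTheorem1
    {Ω : ℕ → Type*} {mΩ : ∀ n, MeasurableSpace (Ω n)}
    (P : ∀ n, Measure (Ω n)) [∀ n, IsProbabilityMeasure (P n)]
    (X : ∀ n, Fin n → Ω n → ℝ)
    (hlaw : ∀ n i, HasLaw (X n i) (gaussianReal 0 1) (P n))
    (hindep : ∀ n, iIndepFun (X n) (P n))
    {Ω' : Type*} {mΩ' : MeasurableSpace Ω'}
    (P' : Measure Ω') [IsProbabilityMeasure P']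
    (Z : Ω' → ℝ) (hZ : HasLaw Z (gaussianReal 0 1) P') :
    absMean = √(2 / Real.pi) ∧
    absVar = 1 - 2 / Real.pi ∧
    kappaSq = 8 * (Real.pi - 3) / Real.pi ^ 2 ∧
    TendstoInDistribution
      (fun n (ω : Ω n) => standardizedRatio (fun i => X n i ω)) atTop Z P P' := by
  refine ⟨absMean_eq, by rw [absVar_eq_sub_sq, absMean_sq], kappaSq_eq, ?_⟩
  -- Convergence in distribution sees only the law for each `n`, so the unrelated samples may be
  -- replaced by initial segments of one i.i.d. sequence, where the strong law makes sense.
  obtain ⟨Ω₀, _, Q, G, -, hGlaw, hGindep, _⟩ := exists_iid ℕ (gaussianReal 0 1)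
  have hlim := tendstoInDistribution_standardizedRatio_of_sequence hGlaw hGindep hZ
  have hid (n : ℕ) : IdentDistrib (fun ω => standardizedRatio (fun i : Fin n => G i ω))
      (fun ω => standardizedRatio (fun i => X n i ω)) Q (P n) :=
    (IdentDistrib.pi (X := fun i : Fin n => G i) (Y := X n)
      (fun i => ⟨(hGlaw i).aemeasurable, (hlaw n i).aemeasurable,
        (hGlaw i).map_eq.trans (hlaw n i).map_eq.symm⟩)
      (hGindep.precomp Fin.val_injective) (hindep n)).comp (measurable_standardizedRatio n)
  exact
    { forall_aemeasurable := fun n => (hid n).aemeasurable_snd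
      aemeasurable_limit := hZ.aemeasurable
      tendsto := hlim.tendsto.congr fun n => Subtype.ext (hid n).map_eq }
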